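/- **Model.** $n \ge 2$ processes with labels $0,\dots,n-1$ communicate in synchronous rounds over a multiple access channel with collision detection. In each round a process either transmits or listens. A process that transmits learns nothing from the channel in that round; a process that listens learns whether no process transmits (silence), exactly one process transmits (it then receives the message), or at least two transmit (collision). An algorithm is a randomized local program for the entry section, with empty exit section, run by every process: what a process does depends only on its own label, its own private independent random draws and the feedback it has received. Neither $n$ nor a global clock is available to it. After each round in its entry section, a process either stays there or moves to its critical section. **Static problem.** The adversary chooses a nonempty set $S\subseteq\{0,\dots,n-1\}$ of processes, all of which start their entry sections at round $1$, while the other processes stay silent in the remainder section forever; she also chooses the (finite, positive) length of the critical section of each process. A process in its critical section transmits a message labelled *critical* in every round; when it leaves that section it goes to the remainder section, where it is silent, and does not come back. The static competition ends when the first process leaves its critical section. An execution is *admissible* if in no round two processes are in their critical sections. An algorithm *solves the static $\varepsilon$-mutual-exclusion problem* for $n$ processes if, against every choice of the adversary, the execution is non-admissible with probability at most $\varepsilon$, and almost surely some process enters its critical section. The *makespan* of an execution is the maximum length of a time interval, before the end of the static competition, in which there is some process in the entry section and none in the critical section. The *expected makespan* for $n$ processes is the supremum, over all choices of the adversary, of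 the expectation of the makespan conditioned on the execution being admissible. **Theorem.** There is an absolute constant $C>0$ such that for every $\varepsilon\in(0,1)$ there is an algorithm which, for every $n\ge 2$, solves the static $\varepsilon$-mutual-exclusion problem for $n$ processes in the model with collision detection, with expected makespan at most $$C\,\bigl(1+\log\log n+\log(1/\varepsilon)\bigr).$$ -/

import Mathlib

open MeasureTheory ProbabilityTheory
open scoped ENNReal

/-! Static mutual exclusion on a multiple access channel with collision detection.
Processes carry labels `0, …, n - 1`; rounds are numbered from `0`. -/

namespace MAC

/-- Messages on the channel: critical messages, which are sent exactly by the processes in the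
critical section, and ordinary messages, which carry a natural number. -/
inductive Message
  | critical
  | plain (content : ℕ)

/-- What a process observes in a round. A process that transmits does not listen, so it learns
nothing (`sent`). A process that listens distinguishes silence, a single message, and a
collision. -/
inductive Feedback
  | sent
  | silence
  | received (m : Message)
  | collision

/-- A randomized algorithm for the entry section; the exit section is empty. It is a local
program: it may use the label of the process, private random draws and the feedback of the
channel, but neither a global clock nor the number of processes. In every round each process
draws a fresh random number, distributed as `coin`, independently of everything else.
* `init p` is the state in which the process with label `p` starts its entry section;
* `send s u` is the action of the round, in state `s` with random draw `u`: `some m` means that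
  the process transmits the message `m`, and `none` that it listens;
* `step s u f` is the state after the round, if the feedback was `f`; the value `none` means
  that the process moves to its critical section before the next round. -/
structure Algorithm where
  State : Type
  coin : PMF ℕ
  init : ℕ → State
  send : State → ℕ → Option ℕ
  step : State → ℕ → Feedback → Option State

/-- The section in which a process is in a round: the remainder section, the entry section in
local state `s`, or the critical section with `r` rounds to go, the present one included. -/
inductive Phase (σ : Type)
  | remainder
  | entry (s : σ)
  | critical (r : ℕ)

/-- A strategy of the adversary in the static problem with `n` processes: a nonempty set of
processes, all of which start their entry sections in the very first round, while all other
processes stay in the remainder section forever, and the lengths of the critical sections.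
A process that has left its critical section stays in the remainder section. -/
structure StaticStrategy (n : ℕ) where
  active : Finset ℕ
  active_nonempty : active.Nonempty
  active_lt : ∀ p ∈ active, p < n
  duration : ℕ → ℕ
  duration_pos : ∀ p, 1 ≤ duration p

namespace Algorithm

variable (A : Algorithm)

/-- Sample points: `ω (t, p)` is the random draw of the process `p` in round `t`. -/
abbrev Sample : Type := ℕ × ℕ → ℕ

/-- All random draws are independent and distributed as `A.coin`. -/
noncomputable def prob : Measure Sample :=
  Measure.infinitePi fun _ : ℕ × ℕ => A.coin.toMeasure

/-- What a process puts on the channel in a round, as a function of its phase and its random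
draw. -/
def transmission (x : Phase A.State) (u : ℕ) : Option Message :=
  match x with
  | .remainder => none
  | .entry s => (A.send s u).map Message.plain
  | .critical _ => some Message.critical

/-- What a listener hears if `l` is the list of all messages transmitted in the round. -/
def heard (l : List Message) : Feedback :=
  match l with
  | [] => .silence
  | [m] => .received m
  | _ => .collision

/-- The phase of a process in the next round; `u` is its random draw, `f` its feedback, and `d`
the length of its critical section. -/
def nextPhase (x : Phase A.State) (u : ℕ) (f : Feedback) (d : ℕ) : Phase A.State :=
  match x with
  | .remainder => .remainder
  | .entry s =>
    match A.step s u f with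
    | some s' => .entry s'
    | none => .critical d
  | .critical r => if r ≤ 1 then .remainder else .critical (r - 1)

/-- One round of the whole system; `x p` is the phase of process `p` and `u p` its random draw. -/
noncomputable def oneRound {n : ℕ} (P : StaticStrategy n) (x : ℕ → Phase A.State) (u : ℕ → ℕ) :
    ℕ → Phase A.State := fun p =>
  let messages : List Message := P.active.toList.filterMap fun q => A.transmission (x q) (u q)
  let feedback : Feedback :=
    if (A.transmission (x p) (u p)).isSome then .sent else heard messages
  A.nextPhase (x p) (u p) feedback (P.duration p)

/-- The execution: `A.execution P ω t p` is the phase of process `p` in round `t`. -/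
noncomputable def execution {n : ℕ} (P : StaticStrategy n) (ω : Sample) :
    ℕ → ℕ → Phase A.State
  | 0 => fun p => if p ∈ P.active then .entry (A.init p) else .remainder
  | t + 1 => A.oneRound P (execution P ω t) fun p => ω (t, p)

def InEntry {n : ℕ} (P : StaticStrategy n) (ω : Sample) (t p : ℕ) : Prop :=
  ∃ s, A.execution P ω t p = .entry s

def InCritical {n : ℕ} (P : StaticStrategy n) (ω : Sample) (t p : ℕ) : Prop :=
  ∃ r, A.execution P ω t p = .critical r

/-- Some process has already left its critical section; this ends the static competition. -/
def Released {n : ℕ} (P : StaticStrategy n) (ω : Sample) (t : ℕ) : Prop :=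
  ∃ p ∈ P.active, A.execution P ω t p = .remainder

/-- The admissible executions: in no round are two processes in the critical section. -/
def admissible {n : ℕ} (P : StaticStrategy n) : Set Sample :=
  {ω | ∀ t p q, A.InCritical P ω t p → A.InCritical P ω t q → p = q}

/-- The makespan of an execution: the maximum length of a time interval (until the channel is
released) in which there is some process in the entry section and none in the critical
section. -/
noncomputable def makespan {n : ℕ} (P : StaticStrategy n) (ω : Sample) : ℕ∞ :=
  ⨆ (a : ℕ) (k : ℕ) (_ : ∀ t, a ≤ t → t < a + k →
      ¬ A.Released P ω t ∧ (∃ p, A.InEntry P ω t p) ∧ ∀ p, ¬ A.InCritical P ω t p), (k : ℕ∞)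

/-- The expected makespan for `n` processes: the supremum over all strategies of the adversary
of the mean makespan of the admissible executions. -/
noncomputable def expectedMakespan (n : ℕ) : ℝ≥0∞ :=
  ⨆ P : StaticStrategy n, ∫⁻ ω, (A.makespan P ω : ℝ≥0∞) ∂(A.prob[|A.admissible P])

/-- `A` solves the static `ε`-mutual-exclusion problem for `n` processes, against every strategy:
`ε`-exclusion (with probability at most `ε` there is ever a process that shares the critical
section with another one) and no deadlock (almost surely some process enters the critical
section). A process leaves the exit section at once, as this section is empty. -/
def SolvesStatic (ε : ℝ) (n : ℕ) : Prop :=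
  ∀ P : StaticStrategy n,
    A.prob (A.admissible P)ᶜ ≤ ENNReal.ofReal ε ∧
    ∀ᵐ ω ∂A.prob, ∃ t p, A.InCritical P ω t p

end Algorithm

end MAC

/-! All active processes start together, and whether a round is silent is known to everyone, since a
transmitter knows that its own round is not silent. As long as decisions depend on noise alone, the
processes therefore share one stage of a common program, with neither a clock nor `n`.

Being alone is tested `m + 1` times, with `m` about `log (1/ε)`. Each process transmits with
probability 1/2, and in the next round the listeners that heard something echo. The echo is noisy
exactly when some processes transmitted and others listened (`Mixed`). A single process never sees
this and enters after `2 * m + 2` rounds. Two or more miss it in every test with probability at most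
`(1/2)^(m+1)`, and only then can exclusion fail (`admissible_of_mixed`, `prob_not_admissible_le`).

Otherwise a leader is elected. A unary search finds the largest level `L` of an active label. It is
about `log log n`, and `2 ^ 2 ^ L` exceeds the number `k` of active processes by a factor of at
least 4 (`four_mul_card_le`). In each attempt the processes take geometric draws, and `L` rounds of
binary search over thresholds below `2 ^ L` find the highest one still reached. If a single process
reaches it, the listeners confirm this, and it enters while the others stay idle for good
(`At.attempt`). At a threshold near `log₂ (2 * k)`, exactly one process survives with probability at
least 1/8 (`exists_uniqueAbove_ge`). Attempts use disjoint rounds, so the number of failures has a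
geometric tail, and the expected cost is `O(m + L + 1)` (`lintegral_makespan_le`). -/

namespace MAC

/-! ### The local program and the feedback it receives -/

namespace Election

/-- The commonly known part of the local state. -/
inductive Stage
  | flip (i : ℕ) (b : Bool)
  | echo (i : ℕ) (b : Bool)
  | level (r : ℕ)
  | draw (L : ℕ)
  | search (L r lo : ℕ)
  | ack (L : ℕ)
  | idle

/-- The double logarithmic size of a label. -/
def labelLevel (p : ℕ) : ℕ := Nat.clog 2 (Nat.clog 2 (4 * (p + 1)))

/-- Whether a process in stage `c` with label `p` and register `g` transmits on the draw `u`. -/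
def sends (c : Stage) (p g u : ℕ) : Bool :=
  match c with
  | .flip _ _ => decide (1 ≤ u)
  | .echo _ _ => decide (g = 1)
  | .level r => decide (r < labelLevel p)
  | .draw _ => false
  | .search _ 0 lo => decide (lo ≤ g)
  | .search _ (r + 1) lo => decide (lo + 2 ^ r ≤ g)
  | .ack _ => decide (g = 1)
  | .idle => false

/-- The channel was not silent. -/
def noise : Feedback → Bool
  | .silence => false
  | _ => true

/-- The register of a process after a flip: `1` if it listened and heard something. -/
def flipReport : Feedback → ℕ
  | .received _ => 1
  | .collision => 1
  | _ => 0

/-- The register of a process after a candidate round: `2` for the candidates, `1` for the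
listeners who heard exactly one message. -/
def candidateReport : Feedback → ℕ
  | .sent => 2
  | .received _ => 1
  | _ => 0

/-- The transition of the local program. -/
def advance (c : Stage) (g u : ℕ) (f : Feedback) : Option (Stage × ℕ) :=
  match c with
  | .flip i b => some (.echo i b, flipReport f)
  | .echo 0 b => if (b || noise f) then some (.level 0, 0) else none
  | .echo (i + 1) b => some (.flip i (b || noise f), 0)
  | .level r => if noise f then some (.level (r + 1), 0) else some (.draw r, 0)
  | .draw L => some (.search L L 0, u)
  | .search L 0 _ => some (.ack L, candidateReport f)
  | .search L (r + 1) lo => some (.search L r (if noise f then lo + 2 ^ r else lo), g)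
  | .ack L =>
    if g = 2 ∧ noise f = true then none
    else if g = 1 then some (.idle, 0) else some (.draw L, 0)
  | .idle => some (.idle, 0)

/-- The algorithm: `m + 1` tests for being alone, then a search for the largest label level, then
repeated attempts to elect a leader by a binary search for the largest geometric draw. -/
noncomputable def algorithm (coin : PMF ℕ) (m : ℕ) : Algorithm where
  State := Stage × ℕ × ℕ
  coin := coin
  init p := (.flip m false, p, 0)
  send s u := if sends s.1 s.2.1 s.2.2 u then some 0 else none
  step s u f := (advance s.1 s.2.2 u f).map fun x => (x.1, s.2.1, x.2)

/-- The feedback of process `p` if exactly the processes in `X` transmit. -/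
def feedback (X : Finset ℕ) (p : ℕ) : Feedback :=
  if p ∈ X then .sent
  else if X.card = 0 then .silence
  else if X.card = 1 then .received (.plain 0)
  else .collision

/-- The right side does not depend on `p`: `sent` counts as noise, so transmitters and listeners
agree. This is what keeps all processes in a common stage. -/
lemma noise_feedback (X : Finset ℕ) (p : ℕ) : noise (feedback X p) = decide X.Nonempty := by
  unfold feedback
  split_ifs with h1 h2 h3
  · simpa [noise] using ⟨p, h1⟩
  · simp_all [noise]
  · simp [noise, ← Finset.card_pos, h3]
  · simpa [noise] using Finset.card_pos.1 (Nat.pos_of_ne_zero h2)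

lemma flipReport_feedback (X : Finset ℕ) (p : ℕ) :
    flipReport (feedback X p) = 1 ↔ p ∉ X ∧ X.Nonempty := by
  unfold feedback
  split_ifs with h1 h2 h3
  · simp [flipReport, h1]
  · simp_all [flipReport]
  · simpa [flipReport, h1] using Finset.card_pos.1 (by omega)
  · simpa [flipReport, h1] using Finset.card_pos.1 (by omega)

lemma candidateReport_feedback_eq_one (X : Finset ℕ) (p : ℕ) :
    candidateReport (feedback X p) = 1 ↔ p ∉ X ∧ X.card = 1 := by
  unfold feedback
  split_ifs <;> simp [candidateReport, *]

lemma candidateReport_feedback_eq_two (X : Finset ℕ) (p : ℕ) :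
    candidateReport (feedback X p) = 2 ↔ p ∈ X := by
  unfold feedback
  split_ifs <;> simp [candidateReport, *]

/-! ### Execution of the program for a fixed sample point -/

section Dynamics

variable {coin : PMF ℕ} {m n : ℕ} {P : StaticStrategy n} {ω : Algorithm.Sample}

lemma filterMap_ite {α β : Type*} (l : List α) (q : α → Bool) (b : β) :
    (l.filterMap fun a => if q a then some b else none) =
      List.replicate (l.filter q).length b := by
  induction l with
  | nil => simp
  | cons a l ih => by_cases h : q a <;> simp [h, ih, List.replicate_succ]

/-- All active processes are in their entry sections, in the common stage `c`. -/
def At (coin : PMF ℕ) (m : ℕ) (P : StaticStrategy n) (ω : Algorithm.Sample) (t : ℕ) (c : Stage)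
    (g : ℕ → ℕ) : Prop :=
  ∀ p ∈ P.active, (algorithm coin m).execution P ω t p = .entry (c, p, g p)

/-- The set of transmitting processes. -/
def senders (P : StaticStrategy n) (ω : Algorithm.Sample) (t : ℕ) (c : Stage) (g : ℕ → ℕ) :
    Finset ℕ :=
  P.active.filter fun q => sends c q (g q) (ω (t, q))

lemma execution_inactive (A : Algorithm) (t : ℕ) {p : ℕ} (hp : p ∉ P.active) :
    A.execution P ω t p = .remainder := by
  induction t with
  | zero => simp [Algorithm.execution, hp]
  | succ t ih => simp [Algorithm.execution, Algorithm.oneRound, Algorithm.nextPhase, ih]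

/-- All entry messages are `plain 0`, so the channel's message list is determined by the number of
senders, and a round of the system reduces to `advance` applied to `feedback`. -/
lemma At.succ {t : ℕ} {c : Stage} {g : ℕ → ℕ} (h : At coin m P ω t c g) {p : ℕ}
    (hp : p ∈ P.active) :
    (algorithm coin m).execution P ω (t + 1) p =
      match advance c (g p) (ω (t, p)) (feedback (senders P ω t c g) p) with
      | some x => .entry (x.1, p, x.2)
      | none => .critical (P.duration p) := by
  have htr : ∀ q ∈ P.active, (algorithm coin m).transmission
      ((algorithm coin m).execution P ω t q) (ω (t, q)) =
      if sends c q (g q) (ω (t, q)) then some (Message.plain 0) else none := by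
    intro q hq
    rw [h q hq]
    by_cases hs : sends c q (g q) (ω (t, q)) <;> simp [Algorithm.transmission, algorithm, hs]
  have hl : (P.active.toList.filterMap fun q => (algorithm coin m).transmission
      ((algorithm coin m).execution P ω t q) (ω (t, q))) =
      List.replicate (senders P ω t c g).card (Message.plain 0) := by
    rw [List.filterMap_congr (g := fun q => if sends c q (g q) (ω (t, q)) then
      some (Message.plain 0) else none) (fun q hq => htr q (by simpa using hq)), filterMap_ite]
    congr 1
    rw [senders, ← Finset.length_toList]
    refine (List.Perm.length_eq ?_)
    rw [List.perm_ext_iff_of_nodup (P.active.nodup_toList.filter _) (Finset.nodup_toList _)]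
    intro a
    simp
  have hfb : (if ((algorithm coin m).transmission
      ((algorithm coin m).execution P ω t p) (ω (t, p))).isSome then Feedback.sent
      else Algorithm.heard (P.active.toList.filterMap fun q => (algorithm coin m).transmission
      ((algorithm coin m).execution P ω t q) (ω (t, q)))) =
      feedback (senders P ω t c g) p := by
    rw [hl, htr p hp]
    have hmem : p ∈ senders P ω t c g ↔ sends c p (g p) (ω (t, p)) = true := by
      simp [senders, hp]
    unfold feedback
    by_cases hs : sends c p (g p) (ω (t, p))
    · simp [hs, hmem.2 hs]
    · have : p ∉ senders P ω t c g := fun h' => hs (hmem.1 h')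
      simp only [hs, this, if_false]
      generalize (senders P ω t c g).card = k
      match k with
      | 0 => simp [Algorithm.heard]
      | 1 => simp [Algorithm.heard]
      | k + 2 => simp [Algorithm.heard, List.replicate_succ]
  rw [Algorithm.execution, Algorithm.oneRound]
  simp only [hfb]
  rw [h p hp]
  simp only [Algorithm.nextPhase, algorithm]
  cases advance c (g p) (ω (t, p)) (feedback (senders P ω t c g) p) <;> rfl

lemma At.succ_entry {t : ℕ} {c : Stage} {g : ℕ → ℕ} (h : At coin m P ω t c g) {c' : Stage}
    {g' : ℕ → ℕ} (hadv : ∀ p ∈ P.active,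
      advance c (g p) (ω (t, p)) (feedback (senders P ω t c g) p) = some (c', g' p)) :
    At coin m P ω (t + 1) c' g' := by
  intro p hp
  rw [h.succ hp, hadv p hp]

lemma entry_of_succ (A : Algorithm) {t p : ℕ} (h : A.InEntry P ω (t + 1) p) :
    A.InEntry P ω t p := by
  obtain ⟨s, hs⟩ := h
  rw [Algorithm.execution, Algorithm.oneRound] at hs
  cases hx : A.execution P ω t p with
  | remainder => simp [hx, Algorithm.nextPhase] at hs
  | entry s => exact ⟨s, hx⟩
  | critical r =>
    simp only [hx, Algorithm.nextPhase] at hs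
    split_ifs at hs

lemma entry_mono (A : Algorithm) {t t' p : ℕ} (htt : t ≤ t') (h : A.InEntry P ω t' p) :
    A.InEntry P ω t p := by
  induction t', htt using Nat.le_induction with
  | base => exact h
  | succ k _ ih => exact ih (entry_of_succ A h)

lemma not_critical_of_entry (A : Algorithm) {t p : ℕ} (h : A.InEntry P ω t p) :
    ¬ A.InCritical P ω t p := by
  rintro ⟨r, hr⟩
  obtain ⟨s, hs⟩ := h
  rw [hs] at hr
  cases hr

lemma active_of_critical (A : Algorithm) {t p : ℕ} (h : A.InCritical P ω t p) :
    p ∈ P.active := by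
  by_contra hp
  obtain ⟨r, hr⟩ := h
  rw [execution_inactive A t hp] at hr
  cases hr

/-- The entry section is never re-entered, so a common entry stage at a later round rules out
critical processes at every earlier one. -/
lemma At.not_critical {t t' : ℕ} {c : Stage} {g : ℕ → ℕ} (h : At coin m P ω t' c g)
    (htt : t ≤ t') (p : ℕ) : ¬ (algorithm coin m).InCritical P ω t p := fun hc =>
  not_critical_of_entry _ (entry_mono _ htt ⟨_, h p (active_of_critical _ hc)⟩) hc

/-- A process that has been in its critical section never returns to its entry section; from
then on it is critical or it has released the channel. -/
lemma critical_or_released (A : Algorithm) {t t' p : ℕ} (htt : t ≤ t')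
    (h : A.InCritical P ω t p) : A.InCritical P ω t' p ∨ A.Released P ω t' := by
  have hp := active_of_critical A h
  suffices A.InCritical P ω t' p ∨ A.execution P ω t' p = .remainder from
    this.imp_right fun h => ⟨p, hp, h⟩
  induction t', htt using Nat.le_induction with
  | base => exact Or.inl h
  | succ k _ ih =>
    unfold Algorithm.InCritical
    rw [Algorithm.execution, Algorithm.oneRound]
    rcases ih with ⟨r, hr⟩ | hr
    · simp only [hr, Algorithm.nextPhase]
      split_ifs
      · exact Or.inr rfl
      · exact Or.inl ⟨_, rfl⟩
    · simp only [hr, Algorithm.nextPhase]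
      exact Or.inr trivial

/-- The makespan is at most the first time at which some process is critical. -/
lemma makespan_le (A : Algorithm) {T p : ℕ} (h : A.InCritical P ω T p) :
    A.makespan P ω ≤ T := by
  refine iSup_le fun a => iSup_le fun k => iSup_le fun hak => ?_
  by_contra hk
  have hk' : T < k := by exact_mod_cast not_le.1 hk
  -- The last round of an interval longer than `T` is at or after `T`, wherever the interval starts.
  have h1 := hak (a + k - 1) (by omega) (by omega)
  rcases critical_or_released A (show T ≤ a + k - 1 by omega) h with h2 | h2
  · exact h1.2.2 p h2
  · exact h1.1 h2

/-! ### The tests for being alone -/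

/-- In the test that starts at round `t`, some processes transmit and some listen. -/
def Mixed (P : StaticStrategy n) (ω : Algorithm.Sample) (t : ℕ) : Prop :=
  (∃ p ∈ P.active, 1 ≤ ω (t, p)) ∧ ∃ p ∈ P.active, ω (t, p) = 0

/-- An echo needs a listener and something for it to hear, that is, both outcomes of the flip among
the active processes. -/
lemma At.flip {t i : ℕ} {b : Bool} {g : ℕ → ℕ} (h : At coin m P ω t (.flip i b) g) :
    ∃ g', At coin m P ω (t + 1) (.echo i b) g' ∧
      ((senders P ω (t + 1) (.echo i b) g').Nonempty ↔ Mixed P ω t) := by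
  refine ⟨fun p => flipReport (feedback (senders P ω t (.flip i b) g) p),
    h.succ_entry fun p hp => rfl, ?_⟩
  constructor
  · rintro ⟨q, hq⟩
    simp only [senders, sends, Finset.mem_filter, decide_eq_true_eq, flipReport_feedback] at hq
    obtain ⟨hqa, hq1, r, hr⟩ := hq
    simp only [Finset.mem_filter] at hr
    exact ⟨⟨r, hr⟩, q, hqa, by_contra fun h0 => hq1 ⟨hqa, by omega⟩⟩
  · rintro ⟨⟨r, hr⟩, q, hqa, hq⟩
    refine ⟨q, ?_⟩
    simp only [senders, sends, Finset.mem_filter, decide_eq_true_eq, flipReport_feedback]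
    exact ⟨hqa, by simp [hq], r, by simpa using hr⟩

lemma at_flip {i : ℕ} (hi : i ≤ m) :
    ∃ b g, At coin m P ω (2 * i) (.flip (m - i) b) g ∧
      (b = true ↔ ∃ j < i, Mixed P ω (2 * j)) := by
  classical
  induction i with
  | zero =>
    refine ⟨false, fun _ => 0, fun p hp => ?_, by simp⟩
    simp [Algorithm.execution, hp, algorithm]
  | succ i ih =>
    obtain ⟨b, g, h, hb⟩ := ih (by omega)
    obtain ⟨g', h', hs⟩ := h.flip
    obtain ⟨k, hk⟩ : ∃ k, m - i = k + 1 := ⟨m - i - 1, by omega⟩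
    rw [hk] at h' hs
    have hk' : m - (i + 1) = k := by omega
    refine ⟨b || decide (Mixed P ω (2 * i)), fun _ => 0, ?_, ?_⟩
    · refine hk' ▸ h'.succ_entry fun p hp => ?_
      simp only [advance, noise_feedback, hs]
    · simp only [Bool.or_eq_true, hb, decide_eq_true_eq]
      constructor
      · rintro (⟨j, hj, h⟩ | h)
        · exact ⟨j, by omega, h⟩
        · exact ⟨i, by omega, h⟩
      · rintro ⟨j, hj, hM⟩
        rcases Nat.lt_succ_iff_lt_or_eq.1 hj with hj | rfl
        · exact Or.inl ⟨j, hj, hM⟩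
        · exact Or.inr hM

/-- Every echo is silent, so each process believes itself alone. With two or more active processes
this is the unwanted event: all of them enter in the same round. -/
lemma critical_of_not_mixed (h : ∀ i ≤ m, ¬ Mixed P ω (2 * i)) {p : ℕ} (hp : p ∈ P.active) :
    (algorithm coin m).InCritical P ω (2 * m + 2) p := by
  obtain ⟨b, g, hat, hb⟩ := at_flip (coin := coin) (P := P) (ω := ω) (le_refl m)
  obtain ⟨g', h', hs⟩ := hat.flip
  have hb0 : b = false := by
    rw [← Bool.not_eq_true, hb]
    rintro ⟨j, hj, hj'⟩
    exact h j hj.le hj'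
  rw [Nat.sub_self] at h' hs
  refine ⟨P.duration p, ?_⟩
  rw [h'.succ hp]
  have hsil : ¬ (senders P ω (2 * m + 1) (.echo 0 false) g').Nonempty := by
    rw [← hb0, hs]; exact h m le_rfl
  simp [advance, noise_feedback, hb0, hsil]

lemma at_level_zero (h : ∃ i ≤ m, Mixed P ω (2 * i)) :
    At coin m P ω (2 * m + 2) (.level 0) fun _ => 0 := by
  obtain ⟨b, g, hat, hb⟩ := at_flip (coin := coin) (P := P) (ω := ω) (le_refl m)
  obtain ⟨g', h', hs⟩ := hat.flip
  rw [Nat.sub_self] at h' hs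
  refine h'.succ_entry fun p hp => ?_
  have : b = true ∨ Mixed P ω (2 * m) := by
    obtain ⟨i, hi, h⟩ := h
    rcases hi.lt_or_eq with hi | rfl
    · exact Or.inl (hb.2 ⟨i, hi, h⟩)
    · exact Or.inr h
  simp [advance, noise_feedback, hs, this]

/-! ### The level phase -/

/-- The largest level of an active label. -/
def topLevel (P : StaticStrategy n) : ℕ := P.active.sup labelLevel

lemma senders_level (t r : ℕ) (g : ℕ → ℕ) :
    (senders P ω t (.level r) g).Nonempty ↔ r < topLevel P := by
  rw [topLevel, Finset.lt_sup_iff]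
  simp [senders, sends, Finset.Nonempty]

/-- The round in which attempt `i` starts. -/
def attemptStart (m : ℕ) (P : StaticStrategy n) (i : ℕ) : ℕ :=
  2 * m + 2 + topLevel P + 1 + i * (topLevel P + 3)

/-- The unary search has `topLevel P` noisy rounds and one silent round that ends it, whence the `+
1` in `attemptStart`. -/
lemma at_draw_zero (h : ∃ i ≤ m, Mixed P ω (2 * i)) :
    At coin m P ω (attemptStart m P 0) (.draw (topLevel P)) fun _ => 0 := by
  have key : ∀ r ≤ topLevel P, At coin m P ω (2 * m + 2 + r) (.level r) fun _ => 0 := by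
    intro r hr
    induction r with
    | zero => exact at_level_zero h
    | succ r ih =>
      refine (ih (by omega)).succ_entry fun p hp => ?_
      have : r < topLevel P := hr
      simp [advance, noise_feedback, senders_level, this]
  have h1 := (key _ le_rfl).succ_entry (c' := .draw (topLevel P)) (g' := fun _ => 0) fun p hp => by
    simp [advance, noise_feedback, senders_level]
  simpa [attemptStart] using h1

/-! ### Election attempts -/

/-- The processes whose draw in round `t` is at least `x`. -/
def above (P : StaticStrategy n) (ω : Algorithm.Sample) (t x : ℕ) : Finset ℕ :=
  P.active.filter fun p => x ≤ ω (t, p)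

lemma above_anti (t : ℕ) {x y : ℕ} (h : x ≤ y) : above P ω t y ⊆ above P ω t x := by
  intro p hp
  simp only [above, Finset.mem_filter] at hp ⊢
  exact ⟨hp.1, h.trans hp.2⟩

/-- Binary search works because `above` decreases in the threshold. Geometric draws are unbounded,
so the upper end of the range may never have been tested; hence the alternative `lo + 1 = 2 ^ L`. -/
lemma At.search {t L : ℕ} {g : ℕ → ℕ} (h : At coin m P ω t (.draw L) g) :
    ∃ lo < 2 ^ L, (above P ω t lo).Nonempty ∧
      (above P ω t (lo + 1) = ∅ ∨ lo + 1 = 2 ^ L) ∧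
      At coin m P ω (t + 1 + L) (.search L 0 lo) fun p => ω (t, p) := by
  have h0 : At coin m P ω (t + 1) (.search L L 0) fun p => ω (t, p) :=
    h.succ_entry fun p hp => rfl
  -- Invariant: somebody reaches the lower end of the current interval, and nobody reaches its upper
  -- end unless that is still the initial `2 ^ L`.
  have key : ∀ i ≤ L, ∃ lo, lo + 2 ^ (L - i) ≤ 2 ^ L ∧ (above P ω t lo).Nonempty ∧
      (above P ω t (lo + 2 ^ (L - i)) = ∅ ∨ lo + 2 ^ (L - i) = 2 ^ L) ∧
      At coin m P ω (t + 1 + i) (.search L (L - i) lo) fun p => ω (t, p) := by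
    intro i hi
    induction i with
    | zero => exact ⟨0, by simp, by simpa [above] using P.active_nonempty, by simp, h0⟩
    | succ i ih =>
      obtain ⟨lo, hlo, hne, htop, hat⟩ := ih (by omega)
      obtain ⟨k, hk⟩ : ∃ k, L - i = k + 1 := ⟨L - i - 1, by omega⟩
      have hk' : L - (i + 1) = k := by omega
      rw [hk] at hlo htop hat
      rw [hk']
      have h2 : 2 ^ (k + 1) = 2 ^ k + 2 ^ k := by ring
      have hsend : senders P ω (t + 1 + i) (.search L (k + 1) lo) (fun p => ω (t, p)) =
          above P ω t (lo + 2 ^ k) := by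
        simp [senders, sends, above]
      have hpos := Nat.two_pow_pos k
      rw [h2] at hlo htop
      by_cases hX : (above P ω t (lo + 2 ^ k)).Nonempty
      · refine ⟨lo + 2 ^ k, by omega, hX, ?_, hat.succ_entry fun p hp => ?_⟩
        · rwa [← add_assoc] at htop
        · simp [advance, noise_feedback, hsend, hX]
      · refine ⟨lo, by omega, hne, Or.inl (Finset.not_nonempty_iff_eq_empty.1 hX),
          hat.succ_entry fun p hp => ?_⟩
        simp [advance, noise_feedback, hsend, hX]
  obtain ⟨lo, h1, h2, h3, h4⟩ := key L le_rfl
  simp only [Nat.sub_self, pow_zero] at h1 h3 h4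
  exact ⟨lo, h1, h2, h3, h4⟩

/-- Process `w` is the only one that has entered its critical section, and the other processes
listen forever. -/
def Won (coin : PMF ℕ) (m : ℕ) (P : StaticStrategy n) (ω : Algorithm.Sample) (t w : ℕ) : Prop :=
  ((algorithm coin m).execution P ω t w = .remainder ∨ (algorithm coin m).InCritical P ω t w) ∧
    ∀ p ∈ P.active, p ≠ w → ∃ g, (algorithm coin m).execution P ω t p = .entry (.idle, p, g)

lemma Won.succ {t w : ℕ} (h : Won coin m P ω t w) : Won coin m P ω (t + 1) w := by
  refine ⟨?_, fun p hp hpw => ⟨0, ?_⟩⟩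
  · unfold Algorithm.InCritical
    rw [Algorithm.execution, Algorithm.oneRound]
    rcases h.1 with hr | ⟨r, hr⟩
    · simp only [hr, Algorithm.nextPhase]
      exact Or.inl trivial
    · simp only [hr, Algorithm.nextPhase]
      split_ifs
      · exact Or.inl rfl
      · exact Or.inr ⟨_, rfl⟩
  · obtain ⟨g, hg⟩ := h.2 p hp hpw
    rw [Algorithm.execution, Algorithm.oneRound]
    simp only [hg, Algorithm.nextPhase]
    rfl

lemma Won.mono {t t' w : ℕ} (h : Won coin m P ω t w) (htt : t ≤ t') : Won coin m P ω t' w := by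
  induction t', htt using Nat.le_induction with
  | base => exact h
  | succ k _ ih => exact ih.succ

lemma Won.eq_of_critical {t w p : ℕ} (h : Won coin m P ω t w)
    (hp : (algorithm coin m).InCritical P ω t p) : p = w := by
  by_contra hpw
  obtain ⟨g, hg⟩ := h.2 p (active_of_critical _ hp) hpw
  exact not_critical_of_entry _ ⟨_, hg⟩ hp

/-- Let `X` be the set of candidates at the threshold found. If `X` is a singleton, its listeners
acknowledge and the candidate enters. If not, `X` has at least two members, so every threshold up to
`lo` is reached at least twice, while those in `(lo, 2 ^ L)` are reached by nobody: a failed attempt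
excludes a unique survivor at every `j < 2 ^ L`. -/
lemma At.attempt {t L : ℕ} {g : ℕ → ℕ} (h : At coin m P ω t (.draw L) g)
    (hcard : 2 ≤ P.active.card) :
    ((∃ g', At coin m P ω (t + L + 3) (.draw L) g') ∧
        ∀ j < 2 ^ L, (above P ω t j).card ≠ 1) ∨
      ∃ g' w, At coin m P ω (t + L + 2) (.ack L) g' ∧ Won coin m P ω (t + L + 3) w ∧
        (algorithm coin m).InCritical P ω (t + L + 3) w := by
  obtain ⟨lo, hlo, hne, htop, hat⟩ := h.search
  set X := above P ω t lo with hX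
  have hsend : senders P ω (t + 1 + L) (.search L 0 lo) (fun p => ω (t, p)) = X := by
    simp [senders, sends, hX, above]
  set g' : ℕ → ℕ := fun p => candidateReport (feedback X p) with hg'
  have hack : At coin m P ω (t + L + 2) (.ack L) g' := by
    have : At coin m P ω (t + 1 + L + 1) (.ack L) g' :=
      hat.succ_entry fun p hp => by simp [advance, hsend, hg']
    rwa [show t + L + 2 = t + 1 + L + 1 by ring]
  have hmem : ∀ p, p ∈ senders P ω (t + L + 2) (.ack L) g' ↔
      p ∈ P.active ∧ p ∉ X ∧ X.card = 1 := by
    intro p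
    simp [senders, sends, hg', candidateReport_feedback_eq_one]
  by_cases h1 : X.card = 1
  · right
    obtain ⟨w, hw⟩ := Finset.card_eq_one.1 h1
    have hwa : w ∈ P.active := by
      have : w ∈ X := by simp [hw]
      rw [hX, above, Finset.mem_filter] at this
      exact this.1
    -- A candidate cannot hear its own success, so a second active process is needed to acknowledge
    -- it.
    obtain ⟨v, hva, hvw⟩ := Finset.exists_mem_ne (s := P.active) (by omega) w
    have hnoise : (senders P ω (t + L + 2) (.ack L) g').Nonempty :=
      ⟨v, (hmem v).2 ⟨hva, by simp [hw, hvw], h1⟩⟩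
    have hcrit : (algorithm coin m).InCritical P ω (t + L + 3) w := by
      refine ⟨P.duration w, ?_⟩
      rw [hack.succ hwa]
      have : g' w = 2 := (candidateReport_feedback_eq_two X w).2 (by simp [hw])
      simp [advance, noise_feedback, hnoise, this]
    refine ⟨g', w, hack, ⟨Or.inr hcrit, fun p hp hpw => ⟨0, ?_⟩⟩, hcrit⟩
    rw [hack.succ hp]
    have : g' p = 1 := (candidateReport_feedback_eq_one X p).2 ⟨by simp [hw, hpw], h1⟩
    simp [advance, this]
  · left
    have hsil : ¬ (senders P ω (t + L + 2) (.ack L) g').Nonempty := by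
      rintro ⟨p, hp⟩
      exact h1 ((hmem p).1 hp).2.2
    refine ⟨⟨fun _ => 0, hack.succ_entry fun p hp => ?_⟩, fun j hj hj1 => ?_⟩
    · have : g' p ≠ 1 := fun h => h1 ((candidateReport_feedback_eq_one X p).1 h).2
      simp [advance, noise_feedback, hsil, this]
    · have h2 : 2 ≤ X.card := by
        have := Finset.card_pos.2 hne
        omega
      have hlt : lo < j := by
        by_contra hle
        have := Finset.card_le_card (above_anti (P := P) (ω := ω) t (not_lt.1 hle))
        rw [hj1, ← hX] at this
        omega
      rcases htop with htop | htop
      · have := Finset.card_le_card (above_anti (P := P) (ω := ω) t (show lo + 1 ≤ j by omega))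
        simp [htop] at this
        simp [this] at hj1
      · omega

lemma attemptStart_succ (i : ℕ) :
    attemptStart m P (i + 1) = attemptStart m P i + topLevel P + 3 := by
  unfold attemptStart; ring

/-- If the tests reveal that nobody is alone, then each attempt is reached or somebody has won
before it. -/
lemma at_draw_or_won (h : ∃ i ≤ m, Mixed P ω (2 * i)) (hcard : 2 ≤ P.active.card) (i : ℕ) :
    (∃ g, At coin m P ω (attemptStart m P i) (.draw (topLevel P)) g) ∨
      ∃ t g c w, t < attemptStart m P i ∧ At coin m P ω t c g ∧ Won coin m P ω (t + 1) w ∧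
        (algorithm coin m).InCritical P ω (t + 1) w := by
  induction i with
  | zero => exact Or.inl ⟨_, at_draw_zero h⟩
  | succ i ih =>
    rw [attemptStart_succ]
    rcases ih with ⟨g, hg⟩ | ⟨t, g, c, w, ht, h1, h2, h3⟩
    · rcases hg.attempt hcard with ⟨h1, -⟩ | ⟨g', w, h1, h2, h3⟩
      · exact Or.inl h1
      · exact Or.inr ⟨_, g', _, w, by omega, h1, h2, h3⟩
    · exact Or.inr ⟨t, g, c, w, by omega, h1, h2, h3⟩

/-- Once the tests have revealed company, entry happens only through a won attempt, after which
everyone else is idle. -/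
lemma admissible_of_mixed (h : ∃ i ≤ m, Mixed P ω (2 * i)) (hcard : 2 ≤ P.active.card) :
    ω ∈ (algorithm coin m).admissible P := by
  intro t p q hp hq
  -- Attempt number `t` starts after round `t`, so it serves as a horizon beyond the round
  -- considered.
  rcases at_draw_or_won (coin := coin) h hcard t with ⟨g, hg⟩ | ⟨t', g, c, w, -, h1, h2, h3⟩
  · refine absurd hp (hg.not_critical ?_ p)
    unfold attemptStart
    nlinarith
  · rcases le_or_gt t t' with htt | htt
    · exact absurd hp (h1.not_critical htt p)
    · have := h2.mono (show t' + 1 ≤ t from htt)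
      rw [this.eq_of_critical hp, this.eq_of_critical hq]

lemma admissible_of_card_eq_one (A : Algorithm) (hcard : P.active.card = 1) :
    ω ∈ A.admissible P := by
  intro t p q hp hq
  exact Finset.card_le_one.1 hcard.le p (active_of_critical A hp) q (active_of_critical A hq)

/-- No `Mixed` hypothesis is needed: if all tests fail, everybody is critical even earlier. The
waiting time is thus controlled by the draws alone, on admissible and other executions alike. -/
lemma exists_critical_of_attempt (hcard : 2 ≤ P.active.card) {i j : ℕ}
    (hj : j < 2 ^ topLevel P) (hij : (above P ω (attemptStart m P i) j).card = 1) :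
    ∃ t ≤ attemptStart m P (i + 1), ∃ p, (algorithm coin m).InCritical P ω t p := by
  by_cases h : ∃ i ≤ m, Mixed P ω (2 * i)
  · rcases at_draw_or_won (coin := coin) h hcard i with ⟨g, hg⟩ | ⟨t, g, c, w, ht, -, -, h3⟩
    · rcases hg.attempt hcard with ⟨-, h1⟩ | ⟨g', w, h1, h2, h3⟩
      · exact absurd hij (h1 j hj)
      · exact ⟨_, by rw [attemptStart_succ], w, h3⟩
    · exact ⟨t + 1, by rw [attemptStart_succ]; omega, w, h3⟩
  · push Not at h
    obtain ⟨p, hp⟩ := P.active_nonempty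
    refine ⟨2 * m + 2, ?_, p, critical_of_not_mixed h hp⟩
    unfold attemptStart
    omega

lemma critical_of_card_eq_one (hcard : P.active.card = 1) {p : ℕ} (hp : p ∈ P.active) :
    (algorithm coin m).InCritical P ω (2 * m + 2) p := by
  refine critical_of_not_mixed (fun i _ hi => ?_) hp
  obtain ⟨⟨q, hq, hq1⟩, r, hr, hr0⟩ := hi
  rw [Finset.card_le_one.1 hcard.le q hq r hr] at hq1
  omega

end Dynamics

/-! ### Geometric draws and independence of rounds -/

section Probability

/-- The geometric distribution with parameter `1 / 2`. -/
noncomputable def geometricCoin : PMF ℕ :=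
  ⟨fun u => 2⁻¹ ^ (u + 1), by
    have h : ∑' u : ℕ, (2⁻¹ : ℝ≥0∞) ^ (u + 1) = 1 := by
      rw [ENNReal.tsum_geometric_add_one, ENNReal.one_sub_inv_two, inv_inv,
        ENNReal.inv_mul_cancel (by simp) (by simp)]
    exact h ▸ ENNReal.summable.hasSum⟩

lemma geometricCoin_real_Ici (j : ℕ) :
    geometricCoin.toMeasure.real (Set.Ici j) = (1 / 2) ^ j := by
  induction j with
  | zero =>
    have : Set.Ici (0 : ℕ) = Set.univ := by ext; simp
    simp [this]
  | succ j ih =>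
    have hsplit : Set.Ici j = {j} ∪ Set.Ici (j + 1) := by
      ext x; simp; omega
    rw [hsplit, measureReal_union (by simp) (MeasurableSet.of_discrete)] at ih
    have h1 : geometricCoin.toMeasure.real {j} = (1 / 2) ^ (j + 1) := by
      rw [Measure.real, PMF.toMeasure_apply_singleton _ _ (measurableSet_singleton j)]
      have : geometricCoin j = 2⁻¹ ^ (j + 1) := rfl
      simp [this]
    rw [h1] at ih
    have : (1 / 2 : ℝ) ^ j = (1 / 2) ^ (j + 1) + (1 / 2) ^ (j + 1) := by ring
    linarith

lemma geometricCoin_real_Iio (j : ℕ) :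
    geometricCoin.toMeasure.real (Set.Iio j) = 1 - (1 / 2) ^ j := by
  rw [← Set.compl_Ici, probReal_compl_eq_one_sub MeasurableSet.of_discrete,
    geometricCoin_real_Ici]

/-- The joint distribution of the draws of all processes in one round. -/
noncomputable def rowMeasure : Measure (ℕ → ℕ) :=
  Measure.infinitePi fun _ : ℕ => geometricCoin.toMeasure

instance : IsProbabilityMeasure rowMeasure := by
  unfold rowMeasure; infer_instance

lemma rowMeasure_real_pi (S : Finset ℕ) (B : ℕ → Set ℕ) :
    rowMeasure.real (Set.pi S B) = ∏ p ∈ S, geometricCoin.toMeasure.real (B p) := by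
  rw [Measure.real, rowMeasure,
    Measure.infinitePi_pi _ fun _ _ => MeasurableSet.of_discrete, ENNReal.toReal_prod]
  rfl

/-- Exactly one process in `S` draws at least `j`. -/
def uniqueAbove (S : Finset ℕ) (j : ℕ) : Set (ℕ → ℕ) :=
  {u | (S.filter fun p => j ≤ u p).card = 1}

/-- Splitting by the identity of the survivor gives disjoint boxes, whose product measure is
explicit. -/
lemma uniqueAbove_eq (S : Finset ℕ) (j : ℕ) :
    uniqueAbove S j =
      ⋃ p ∈ S, Set.pi S fun q => if q = p then Set.Ici j else Set.Iio j := by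
  ext u
  simp only [uniqueAbove, Set.mem_ofPred_eq, Finset.card_eq_one, Set.mem_iUnion, Set.mem_pi,
    Finset.mem_coe, exists_prop]
  constructor
  · rintro ⟨p, hp⟩
    have hmem : ∀ q, (q ∈ S ∧ j ≤ u q) ↔ q = p := fun q => by
      rw [← Finset.mem_singleton, ← hp, Finset.mem_filter]
    refine ⟨p, ((hmem p).2 rfl).1, fun q hq => ?_⟩
    split_ifs with hqp
    · exact ((hmem q).2 hqp).2
    · exact not_le.1 fun h => hqp ((hmem q).1 ⟨hq, h⟩)
  · rintro ⟨p, hpS, hp⟩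
    refine ⟨p, ?_⟩
    ext q
    rw [Finset.mem_filter, Finset.mem_singleton]
    constructor
    · rintro ⟨hq, hj⟩
      by_contra hqp
      have := hp q hq
      rw [if_neg hqp] at this
      exact not_le.2 this hj
    · rintro rfl
      have := hp q hpS
      rw [if_pos rfl] at this
      exact ⟨hpS, this⟩

lemma measurableSet_pi_finset (S : Finset ℕ) (B : ℕ → Set ℕ) :
    MeasurableSet (Set.pi (S : Set ℕ) B) :=
  MeasurableSet.pi S.countable_toSet fun _ _ => MeasurableSet.of_discrete

lemma measurableSet_uniqueAbove (S : Finset ℕ) (j : ℕ) : MeasurableSet (uniqueAbove S j) := by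
  rw [uniqueAbove_eq]
  exact Finset.measurableSet_biUnion _ fun _ _ => measurableSet_pi_finset _ _

lemma rowMeasure_real_uniqueAbove (S : Finset ℕ) (j : ℕ) :
    rowMeasure.real (uniqueAbove S j) =
      S.card * ((1 / 2) ^ j * (1 - (1 / 2) ^ j) ^ (S.card - 1)) := by
  rw [uniqueAbove_eq, measureReal_biUnion_finset]
  · rw [Finset.sum_congr rfl (g := fun _ => (1 / 2 : ℝ) ^ j * (1 - (1 / 2) ^ j) ^ (S.card - 1)),
      Finset.sum_const, nsmul_eq_mul]
    intro p hp
    rw [rowMeasure_real_pi, ← Finset.mul_prod_erase _ _ hp, if_pos rfl, geometricCoin_real_Ici,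
      Finset.prod_congr rfl (g := fun _ => 1 - (1 / 2 : ℝ) ^ j), Finset.prod_const,
      Finset.card_erase_of_mem hp]
    intro q hq
    rw [if_neg (Finset.ne_of_mem_erase hq), geometricCoin_real_Iio]
  · intro p hp q hq hpq
    refine Set.disjoint_left.2 fun u hu hu' => ?_
    have h1 := hu p hp
    have h2 := hu' p hp
    simp only [if_true] at h1
    simp only [if_neg hpq] at h2
    exact not_le.2 (Set.mem_Iio.1 h2) (Set.mem_Ici.1 h1)
  · exact fun _ _ => measurableSet_pi_finset _ _

/-- Choose `j` with `2 * k ≤ 2 ^ j < 4 * k` and put `x = 2 ^ (-j)`, so that `k * x` lies in `[1/4,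
1/2]`. By Bernoulli's inequality `(1 - x) ^ (k - 1) ≥ 1/2`, and the product is at least 1/8. -/
lemma exists_uniqueAbove_ge {S : Finset ℕ} (hS : 2 ≤ S.card) {N : ℕ} (hN : 4 * S.card ≤ 2 ^ N) :
    ∃ j < N, 1 / 8 ≤ rowMeasure.real (uniqueAbove S j) := by
  set k := S.card with hk
  set j := Nat.clog 2 (2 * k) with hj
  have h1 : 2 * k ≤ 2 ^ j := Nat.le_pow_clog one_lt_two _
  have h2 : 2 ^ j < 4 * k := by
    have h3 : 2 ^ (j - 1) < 2 * k := Nat.pow_pred_clog_lt_self one_lt_two (by omega)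
    have h4 : 0 < j := Nat.clog_pos one_lt_two (by omega)
    have h5 : 2 ^ j = 2 * 2 ^ (j - 1) := by
      rw [← pow_succ']; congr 1; omega
    omega
  refine ⟨j, (Nat.pow_lt_pow_iff_right one_lt_two).1 (h2.trans_le hN), ?_⟩
  rw [rowMeasure_real_uniqueAbove, ← hk]
  set x : ℝ := (1 / 2) ^ j with hx
  have hx0 : 0 < x := by positivity
  have hxe : x * 2 ^ j = 1 := by rw [hx, ← mul_pow]; norm_num
  have hu : k * x ≤ 1 / 2 := by
    have : (2 * k : ℝ) ≤ 2 ^ j := by exact_mod_cast h1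
    nlinarith
  have hl : 1 / 4 ≤ k * x := by
    have : (2 : ℝ) ^ j ≤ 4 * k := by exact_mod_cast h2.le
    nlinarith
  have hk1 : (1 : ℝ) ≤ k := by exact_mod_cast (by omega : 1 ≤ k)
  have hb : 1 / 2 ≤ (1 - x) ^ (k - 1) := by
    have := one_add_mul_le_pow (a := -x) (by nlinarith) (k - 1)
    rw [Nat.cast_sub (by omega)] at this
    rw [sub_eq_add_neg]
    refine le_trans ?_ this
    push_cast
    nlinarith
  rw [← mul_assoc]
  nlinarith

/-- Two processes agree by both transmitting or both listening, each with probability 1/4. A test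
that is not mixed makes any two fixed active processes agree, so one pair suffices. -/
lemma rowMeasure_real_agree_le {p q : ℕ} (hpq : p ≠ q) :
    rowMeasure.real {u | 1 ≤ u p ↔ 1 ≤ u q} ≤ 1 / 2 := by
  have hsub : {u : ℕ → ℕ | 1 ≤ u p ↔ 1 ≤ u q} ⊆
      Set.pi ({p, q} : Finset ℕ) (fun _ => Set.Ici 1) ∪
        Set.pi ({p, q} : Finset ℕ) (fun _ => Set.Iio 1) := by
    intro u hu
    simp only [Set.mem_ofPred_eq] at hu
    by_cases h : 1 ≤ u p
    · left
      intro r hr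
      rcases (by simpa using hr : r = p ∨ r = q) with rfl | rfl
      exacts [h, hu.1 h]
    · right
      intro r hr
      rcases (by simpa using hr : r = p ∨ r = q) with rfl | rfl
      exacts [not_le.1 h, not_le.1 fun h' => h (hu.2 h')]
  refine (measureReal_mono hsub).trans ((measureReal_union_le _ _).trans ?_)
  rw [rowMeasure_real_pi, rowMeasure_real_pi, Finset.prod_const, Finset.prod_const,
    Finset.card_pair hpq, geometricCoin_real_Ici, geometricCoin_real_Iio]
  norm_num

lemma measurableSet_agree (p q : ℕ) : MeasurableSet {u : ℕ → ℕ | 1 ≤ u p ↔ 1 ≤ u q} := by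
  have h : ∀ r : ℕ, MeasurableSet {u : ℕ → ℕ | 1 ≤ u r} := fun r =>
    (measurable_pi_apply r) (MeasurableSet.of_discrete (s := Set.Ici 1))
  exact (h p).iff (h q)

instance (A : Algorithm) : IsProbabilityMeasure A.prob := by
  unfold Algorithm.prob; infer_instance

lemma measurable_row (t : ℕ) : Measurable fun (ω : Algorithm.Sample) (p : ℕ) => ω (t, p) :=
  measurable_pi_lambda _ fun p => measurable_pi_apply (t, p)

/-- Different rounds are independent. -/
lemma prob_rows (m : ℕ) (s : Finset ℕ) {B : ℕ → Set (ℕ → ℕ)} (hB : ∀ t ∈ s, MeasurableSet (B t)) :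
    (algorithm geometricCoin m).prob {ω | ∀ t ∈ s, (fun p => ω (t, p)) ∈ B t} =
      ∏ t ∈ s, rowMeasure (B t) := by
  have h := Measure.infinitePi_map_curry (fun _ _ : ℕ => geometricCoin.toMeasure)
  have h2 := Measure.infinitePi_pi (fun _ : ℕ => rowMeasure) (s := s) (t := B) hB
  unfold rowMeasure at h2
  rw [← h, Measure.map_apply (MeasurableEquiv.measurable _)
    (MeasurableSet.pi s.countable_toSet hB)] at h2
  exact h2

end Probability

/-! ### Error probability and expected waiting time -/

section Bounds

variable {n : ℕ}

/-- Distinct labels force the largest one, `M`, to satisfy `k ≤ M + 1`, and its level was defined by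
rounding up `log₂ log₂ (4 * (M + 1))`. This puts the good threshold inside the search range `2 ^ L`.
-/
lemma four_mul_card_le (P : StaticStrategy n) : 4 * P.active.card ≤ 2 ^ 2 ^ topLevel P := by
  obtain ⟨M, hM, hmax⟩ := P.active.exists_max_image id P.active_nonempty
  have h1 : P.active.card ≤ M + 1 := by
    have : P.active ⊆ Finset.range (M + 1) := fun p hp => by
      have := hmax p hp
      simp only [id] at this
      simp; omega
    simpa using Finset.card_le_card this
  have h2 : labelLevel M ≤ topLevel P := Finset.le_sup hM
  calc 4 * P.active.card ≤ 4 * (M + 1) := by omega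
    _ ≤ 2 ^ Nat.clog 2 (4 * (M + 1)) := Nat.le_pow_clog one_lt_two _
    _ ≤ 2 ^ 2 ^ labelLevel M :=
        Nat.pow_le_pow_right two_pos (Nat.le_pow_clog one_lt_two _)
    _ ≤ _ := Nat.pow_le_pow_right two_pos (Nat.pow_le_pow_right two_pos h2)

lemma prob_not_admissible_le (P : StaticStrategy n) (m : ℕ) :
    (algorithm geometricCoin m).prob ((algorithm geometricCoin m).admissible P)ᶜ ≤
      ENNReal.ofReal ((1 / 2) ^ (m + 1)) := by
  rcases Nat.lt_or_ge 1 P.active.card with hc | hc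
  · obtain ⟨p, hp, q, hq, hpq⟩ := Finset.one_lt_card.1 hc
    -- The flips take place in the even rounds `0, 2, …, 2 * m`; the odd ones are echoes.
    set s := (Finset.range (m + 1)).map ⟨fun i => 2 * i, mul_right_injective₀ two_ne_zero⟩ with hs
    have hsub : ((algorithm geometricCoin m).admissible P)ᶜ ⊆
        {ω | ∀ t ∈ s, (fun p => ω (t, p)) ∈ {u : ℕ → ℕ | 1 ≤ u p ↔ 1 ≤ u q}} := by
      intro ω hω t ht
      simp only [hs, Finset.mem_map, Finset.mem_range, Function.Embedding.coeFn_mk] at ht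
      obtain ⟨i, hi, rfl⟩ := ht
      by_contra hne
      refine hω (admissible_of_mixed ⟨i, by omega, ?_⟩ hc)
      simp only [Set.mem_ofPred_eq] at hne
      unfold Mixed
      by_cases h : 1 ≤ ω (2 * i, p)
      · exact ⟨⟨p, hp, h⟩, q, hq, by by_contra h0; exact hne ⟨fun _ => by omega, fun _ => h⟩⟩
      · exact ⟨⟨q, hq, by by_contra h0; exact hne ⟨fun h' => absurd h' h, fun h' => absurd h' h0⟩⟩,
          p, hp, by omega⟩
    refine (measure_mono hsub).trans ?_
    rw [prob_rows m s fun _ _ => measurableSet_agree p q, Finset.prod_const, hs, Finset.card_map,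
      Finset.card_range, ENNReal.ofReal_pow (by norm_num)]
    gcongr
    rw [ENNReal.le_ofReal_iff_toReal_le (measure_ne_top _ _) (by norm_num)]
    exact rowMeasure_real_agree_le hpq
  · have hc1 : P.active.card = 1 :=
      le_antisymm hc (Finset.card_pos.2 P.active_nonempty)
    have : (algorithm geometricCoin m).admissible P = Set.univ :=
      Set.eq_univ_of_forall fun ω => admissible_of_card_eq_one _ hc1
    simp [this]

/-- None of the attempts `0, …, i` has exactly one process that draws at least `j`. -/
def allFail (m : ℕ) (P : StaticStrategy n) (j i : ℕ) : Set Algorithm.Sample :=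
  {ω | ∀ k ≤ i, (above P ω (attemptStart m P k) j).card ≠ 1}

lemma attemptStart_injective (m : ℕ) (P : StaticStrategy n) :
    Function.Injective (attemptStart m P) :=
  (strictMono_nat_of_lt_succ fun i => by rw [attemptStart_succ]; omega).injective

lemma allFail_eq (m : ℕ) (P : StaticStrategy n) (j i : ℕ) :
    allFail m P j i = {ω | ∀ t ∈ (Finset.range (i + 1)).map
      ⟨attemptStart m P, attemptStart_injective m P⟩,
      (fun p => ω (t, p)) ∈ (uniqueAbove P.active j)ᶜ} := by
  ext ω
  simp [allFail, uniqueAbove, above]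

lemma measurableSet_allFail (m : ℕ) (P : StaticStrategy n) (j i : ℕ) :
    MeasurableSet (allFail m P j i) := by
  rw [allFail_eq]
  convert! Finset.measurableSet_biInter ((Finset.range (i + 1)).map
    ⟨attemptStart m P, attemptStart_injective m P⟩) fun t _ => measurable_row t
    (measurableSet_uniqueAbove P.active j).compl
  ext ω
  simp

/-- The attempt rounds are fixed by `m` and `P`, and `allFail` looks at the raw draws even after
somebody has won, so the failures are independent events. -/
lemma prob_allFail_le {m : ℕ} {P : StaticStrategy n} {j : ℕ}
    (hj : 1 / 8 ≤ rowMeasure.real (uniqueAbove P.active j)) (i : ℕ) :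
    (algorithm geometricCoin m).prob (allFail m P j i) ≤ ENNReal.ofReal (7 / 8) ^ (i + 1) := by
  rw [allFail_eq, prob_rows m _ fun _ _ => (measurableSet_uniqueAbove P.active j).compl,
    Finset.prod_const, Finset.card_map, Finset.card_range]
  gcongr
  rw [ENNReal.le_ofReal_iff_toReal_le (measure_ne_top _ _) (by norm_num)]
  change rowMeasure.real _ ≤ _
  rw [probReal_compl_eq_one_sub (measurableSet_uniqueAbove P.active j)]
  linarith

lemma tsum_failure : ∑' i : ℕ, ENNReal.ofReal (7 / 8) ^ (i + 1) = 7 := by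
  rw [ENNReal.tsum_geometric_add_one, ← ENNReal.ofReal_one,
    ← ENNReal.ofReal_sub _ (by norm_num), ← ENNReal.ofReal_inv_of_pos (by norm_num),
    ← ENNReal.ofReal_mul (by norm_num)]
  norm_num

/-- The sum of indicators counts the attempts before the first good one, so its expectation is a sum
of tail probabilities. If no attempt is good the sum is infinite and nothing is to be shown. -/
lemma makespan_le_of_attempts {m : ℕ} {P : StaticStrategy n} (hc : 2 ≤ P.active.card) {j : ℕ}
    (hj : j < 2 ^ topLevel P) (ω : Algorithm.Sample) :
    ((algorithm geometricCoin m).makespan P ω : ℝ≥0∞) ≤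
      (attemptStart m P 1 : ℕ) + (topLevel P + 3 : ℕ) *
        ∑' i : ℕ, (allFail m P j i).indicator 1 ω := by
  classical
  by_cases h : ∃ i, (above P ω (attemptStart m P i) j).card = 1
  · obtain ⟨t, ht, p, hp⟩ := exists_critical_of_attempt (coin := geometricCoin) (m := m) hc hj
      (Nat.find_spec h)
    set N := Nat.find h with hN
    have hsum : (N : ℝ≥0∞) ≤ ∑' i : ℕ, (allFail m P j i).indicator 1 ω := by
      refine le_trans (le_of_eq ?_) (ENNReal.sum_le_tsum (Finset.range N))
      rw [Finset.sum_congr rfl (g := fun _ => (1 : ℝ≥0∞))]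
      · simp
      · intro i hi
        have hmem : ω ∈ allFail m P j i := fun k hk =>
          Nat.find_min h (hk.trans_lt (Finset.mem_range.1 hi))
        exact Set.indicator_of_mem hmem _
    calc ((algorithm geometricCoin m).makespan P ω : ℝ≥0∞)
        ≤ ((t : ℕ∞) : ℝ≥0∞) := ENat.toENNReal_mono (makespan_le _ hp)
      _ = (t : ℝ≥0∞) := by simp
      _ ≤ ((attemptStart m P 1 + (topLevel P + 3) * N : ℕ) : ℝ≥0∞) := by
          gcongr
          refine ht.trans (le_of_eq ?_)
          unfold attemptStart
          ring
      _ ≤ _ := by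
          rw [Nat.cast_add, Nat.cast_mul]
          gcongr
  · push Not at h
    have : ∀ i, (allFail m P j i).indicator (1 : Algorithm.Sample → ℝ≥0∞) ω = 1 := fun i =>
      Set.indicator_of_mem (show ω ∈ allFail m P j i from fun k _ => h k) _
    simp only [this, ENNReal.tsum_const_eq_top_of_ne_zero one_ne_zero]
    rw [ENNReal.mul_top (by simp)]
    simp

lemma lintegral_makespan_le (m : ℕ) (P : StaticStrategy n) :
    ∫⁻ ω, ((algorithm geometricCoin m).makespan P ω : ℝ≥0∞) ∂(algorithm geometricCoin m).prob ≤
      (2 * m + 9 * topLevel P + 27 : ℕ) := by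
  rcases Nat.lt_or_ge 1 P.active.card with hc | hc
  · obtain ⟨j, hj, hj8⟩ := exists_uniqueAbove_ge hc (four_mul_card_le P)
    refine (lintegral_mono (makespan_le_of_attempts hc hj)).trans ?_
    rw [lintegral_add_left measurable_const, lintegral_const_mul _ (Measurable.tsum
      fun i => measurable_one.indicator (measurableSet_allFail m P j i)), lintegral_tsum
      fun i => (measurable_one.indicator (measurableSet_allFail m P j i)).aemeasurable]
    simp only [lintegral_indicator_one (measurableSet_allFail m P j _), lintegral_const,
      measure_univ, mul_one]
    calc _ ≤ ((attemptStart m P 1 : ℕ) : ℝ≥0∞) + (topLevel P + 3 : ℕ) * 7 := by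
          rw [← tsum_failure]
          gcongr with i
          exact prob_allFail_le hj8 i
      _ = _ := by
          unfold attemptStart
          push_cast
          ring
  · have hc1 : P.active.card = 1 :=
      le_antisymm hc (Finset.card_pos.2 P.active_nonempty)
    obtain ⟨p, hp⟩ := P.active_nonempty
    have : ∀ ω, ((algorithm geometricCoin m).makespan P ω : ℝ≥0∞) ≤
        (2 * m + 9 * topLevel P + 27 : ℕ) := fun ω =>
      calc ((algorithm geometricCoin m).makespan P ω : ℝ≥0∞)
          ≤ (((2 * m + 2 : ℕ) : ℕ∞) : ℝ≥0∞) :=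
            ENat.toENNReal_mono (makespan_le _ (critical_of_card_eq_one hc1 hp))
        _ = ((2 * m + 2 : ℕ) : ℝ≥0∞) := by simp
        _ ≤ _ := by
            exact Nat.cast_le.2 (by omega)
    refine (lintegral_mono this).trans ?_
    simp

lemma ae_exists_critical (m : ℕ) (P : StaticStrategy n) :
    ∀ᵐ ω ∂(algorithm geometricCoin m).prob, ∃ t p,
      (algorithm geometricCoin m).InCritical P ω t p := by
  rcases Nat.lt_or_ge 1 P.active.card with hc | hc
  · obtain ⟨j, hj, hj8⟩ := exists_uniqueAbove_ge hc (four_mul_card_le P)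
    rw [ae_iff, ← nonpos_iff_eq_zero]
    have htend := (ENNReal.tendsto_pow_atTop_nhds_zero_of_lt_one
      (show ENNReal.ofReal (7 / 8) < 1 by rw [ENNReal.ofReal_lt_one]; norm_num)).comp
      (Filter.tendsto_add_atTop_nat 1)
    refine ge_of_tendsto' htend fun i => (measure_mono ?_).trans (prob_allFail_le (m := m) hj8 i)
    intro ω hω k _ h1
    obtain ⟨t, -, p, hp⟩ := exists_critical_of_attempt (coin := geometricCoin) hc hj h1
    exact hω ⟨t, p, hp⟩
  · have hc1 : P.active.card = 1 :=
      le_antisymm hc (Finset.card_pos.2 P.active_nonempty)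
    obtain ⟨p, hp⟩ := P.active_nonempty
    exact ae_of_all _ fun ω => ⟨_, p, critical_of_card_eq_one hc1 hp⟩

/-- Admissibility has probability at least 1/2, since `(1/2)^(m+1) ≤ 1/2`, so conditioning on it at
most doubles the unconditional mean. -/
lemma expectedMakespan_le {m L : ℕ} (hL : ∀ P : StaticStrategy n, topLevel P ≤ L) :
    (algorithm geometricCoin m).expectedMakespan n ≤ (2 * (2 * m + 9 * L + 27) : ℕ) := by
  refine iSup_le fun P => ?_
  set A := algorithm geometricCoin m
  have hadm : (A.prob (A.admissible P))⁻¹ ≤ 2 := by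
    rw [ENNReal.inv_le_iff_inv_le]
    have h1 : A.prob (A.admissible P)ᶜ ≤ 2⁻¹ := by
      refine (prob_not_admissible_le P m).trans ?_
      rw [ENNReal.ofReal_le_iff_le_toReal (by simp), pow_succ]
      have : (1 / 2 : ℝ) ^ m ≤ 1 := pow_le_one₀ (by norm_num) (by norm_num)
      rw [ENNReal.toReal_inv, ENNReal.toReal_ofNat]
      linarith
    have h2 : 1 ≤ A.prob (A.admissible P) + A.prob (A.admissible P)ᶜ := by
      rw [← measure_univ (μ := A.prob), ← Set.union_compl_self (A.admissible P)]
      exact measure_union_le _ _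
    have h3 : (2⁻¹ : ℝ≥0∞) + 2⁻¹ ≤ A.prob (A.admissible P) + 2⁻¹ := by
      rw [ENNReal.inv_two_add_inv_two]
      exact h2.trans (by gcongr)
    exact (ENNReal.add_le_add_iff_right (by simp)).1 h3
  calc ∫⁻ ω, (A.makespan P ω : ℝ≥0∞) ∂(A.prob[|A.admissible P])
      = (A.prob (A.admissible P))⁻¹ *
          ∫⁻ ω in A.admissible P, (A.makespan P ω : ℝ≥0∞) ∂A.prob := by
        rw [ProbabilityTheory.cond, lintegral_smul_measure, smul_eq_mul]
    _ ≤ 2 * (2 * m + 9 * topLevel P + 27 : ℕ) := by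
        gcongr
        exact (setLIntegral_le_lintegral _ _).trans (lintegral_makespan_le m P)
    _ ≤ _ := by
        have := hL P
        norm_cast
        gcongr

/-! ### Comparison with the double logarithm -/

lemma topLevel_le (P : StaticStrategy n) :
    topLevel P ≤ Nat.clog 2 (Nat.clog 2 (4 * n)) := by
  refine Finset.sup_le fun p hp => ?_
  have := P.active_lt p hp
  exact Nat.clog_mono_right _ (Nat.clog_mono_right _ (by omega))

lemma clog_two_le {x : ℕ} (hx : 1 ≤ x) : (Nat.clog 2 x : ℝ) ≤ Real.logb 2 x + 1 := by
  have h := Real.natCeil_logb_natCast 2 x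
  push_cast at h
  rw [← h]
  exact (Nat.ceil_lt_add_one (Real.logb_nonneg one_lt_two (by exact_mod_cast hx))).le

lemma clog_clog_le (hn : 2 ≤ n) :
    (Nat.clog 2 (Nat.clog 2 (4 * n)) : ℝ) ≤ 4 + Real.log (Real.log n) / Real.log 2 := by
  have hl2 : 0 < Real.log 2 := Real.log_pos one_lt_two
  have hl2' := Real.log_two_gt_d9
  have hn' : (2 : ℝ) ≤ n := by exact_mod_cast hn
  have hlogn : 1 ≤ Real.logb 2 n := by
    rw [← Real.logb_self_eq_one one_lt_two]
    exact Real.logb_le_logb_of_le one_lt_two two_pos hn'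
  -- The additive 3 from the factor 4 and the rounding is absorbed by `Real.logb 2 n ≥ 1`.
  have h1 : (Nat.clog 2 (4 * n) : ℝ) ≤ 4 * Real.logb 2 n := by
    refine (clog_two_le (by omega)).trans ?_
    push_cast
    have h4 : Real.logb 2 4 = 2 := by
      rw [show (4 : ℝ) = 2 ^ (2 : ℕ) by norm_num, Real.logb_pow, Real.logb_self_eq_one one_lt_two]
      norm_num
    rw [Real.logb_mul (by norm_num) (by positivity), h4]
    linarith
  have h2 : 1 ≤ Nat.clog 2 (4 * n) := Nat.clog_pos one_lt_two (by omega)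
  refine (clog_two_le h2).trans ?_
  have h3 : Real.logb 2 (Nat.clog 2 (4 * n)) ≤ Real.logb 2 (4 * Real.logb 2 n) :=
    Real.logb_le_logb_of_le one_lt_two (by exact_mod_cast h2) h1
  have h5 : Real.logb 2 (4 * Real.logb 2 n) =
      2 + (Real.log (Real.log n) - Real.log (Real.log 2)) / Real.log 2 := by
    rw [Real.logb, Real.log_mul (by norm_num) (by positivity), Real.logb,
      Real.log_div (Real.log_pos (by linarith)).ne' hl2.ne',
      show (4 : ℝ) = 2 ^ (2 : ℕ) by norm_num, Real.log_pow]
    field_simp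
    push_cast
    ring
  -- The final 4 is made of 2 from the factor 4, 1 from rounding up, and 1 from this change of base.
  have h6 : -Real.log (Real.log 2) / Real.log 2 ≤ 1 := by
    rw [div_le_one hl2]
    have := Real.one_sub_inv_le_log_of_pos hl2
    have : (Real.log 2)⁻¹ ≤ 3 / 2 := by
      rw [inv_le_comm₀ hl2 (by norm_num)]; norm_num; linarith
    linarith
  rw [sub_div] at h5
  rw [neg_div] at h6
  linarith

end Bounds

end Election

end MAC

theorem mainTheorem6 :
    ∃ C : ℝ, 0 < C ∧ ∀ ε : ℝ, 0 < ε → ε < 1 →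
      ∃ A : MAC.Algorithm, ∀ n : ℕ, 2 ≤ n →
        A.SolvesStatic ε n ∧
        A.expectedMakespan n ≤
          ENNReal.ofReal (C * (1 + Real.log (Real.log n) + Real.log (1 / ε))) := by
  -- The value 1000 is generous; no attempt is made to optimise it.
  refine ⟨1000, by norm_num, fun ε hε hε1 => ?_⟩
  have hl2 := Real.log_two_gt_d9
  have hlogε : 0 < Real.log (1 / ε) := Real.log_pos (by rw [lt_div_iff₀ hε]; linarith)
  set m := ⌈Real.logb 2 (1 / ε)⌉₊ with hm
  have hm1 : (m : ℝ) ≤ Real.log (1 / ε) / Real.log 2 + 1 :=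
    (Nat.ceil_lt_add_one (div_nonneg hlogε.le (by linarith))).le
  have hmε : (1 / 2 : ℝ) ^ (m + 1) ≤ ε := by
    have h1 : 1 / ε ≤ 2 ^ m := by
      rw [← Real.rpow_natCast, ← Real.logb_le_iff_le_rpow one_lt_two (by positivity)]
      exact Nat.le_ceil _
    have h2 : (1 / 2 : ℝ) ^ m * 2 ^ m = 1 := by rw [← mul_pow]; norm_num
    have h3 : (0 : ℝ) < (1 / 2) ^ m := by positivity
    have h4 : (1 / 2 : ℝ) ^ m ≤ ε := by
      rw [div_le_iff₀ hε] at h1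
      nlinarith
    rw [pow_succ]
    linarith
  refine ⟨MAC.Election.algorithm MAC.Election.geometricCoin m, fun n hn => ⟨fun P => ⟨?_, ?_⟩, ?_⟩⟩
  · exact (MAC.Election.prob_not_admissible_le P m).trans (ENNReal.ofReal_le_ofReal hmε)
  · exact MAC.Election.ae_exists_critical m P
  · refine (MAC.Election.expectedMakespan_le MAC.Election.topLevel_le).trans ?_
    rw [← ENNReal.ofReal_natCast]
    refine ENNReal.ofReal_le_ofReal ?_
    have hL := MAC.Election.clog_clog_le hn
    -- For `n = 2` the double logarithm is negative; this bound keeps `1 + log log n` at least 1/2,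
    -- which pays for the additive constants.
    have hll : -(1 / 2) ≤ Real.log (Real.log n) := by
      have h1 : Real.log 2 ≤ Real.log n := Real.log_le_log two_pos (by exact_mod_cast hn)
      have h2 := Real.one_sub_inv_le_log_of_pos (show 0 < Real.log n by linarith)
      have h3 : (Real.log n)⁻¹ ≤ 3 / 2 := by
        rw [inv_le_comm₀ (by linarith) (by norm_num)]; norm_num; linarith
      linarith
    -- The shift by 1/2 makes the numerator nonnegative, so that `1 / Real.log 2 ≤ 2` may be
    -- applied.
    have h5 : (Real.log (Real.log n) + 1 / 2) / Real.log 2 ≤ 2 * (Real.log (Real.log n) + 1 / 2) := by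
      rw [div_le_iff₀ (by linarith)]
      nlinarith
    have h6 : Real.log (1 / ε) / Real.log 2 ≤ 2 * Real.log (1 / ε) := by
      rw [div_le_iff₀ (by linarith)]
      nlinarith
    have h7 : 0 ≤ (1 / 2) / Real.log 2 := div_nonneg (by norm_num) (by linarith)
    rw [add_div] at h5
    push_cast
    linarith
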